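/- Let $1\to R\to F\xrightarrow{\pi}G\to 1$ be a presentation of finite type of a discrete group $G$ ($F$ the free group on a finite set, $R$ the normal closure in $F$ of finitely many elements), respectively, for a fixed prime $p$, a pro-$p$ presentation of finite type of a pro-$p$ group $G$ ($F$ the free pro-$p$ group on a finite set, $\pi$ continuous, $R$ the smallest closed normal subgroup of $F$ containing some finite set of elements). For a prime $p$ and $n\ge 1$ let $\mathcal M_n=\{f\in F\mid f-1\in\Delta_p^n\}$ be the Zassenhaus $p$-filtration of $F$; here in the discrete case $\Delta_p^n$ is the $n$-th power of the augmentation ideal $\Delta_p$ of the group ring $\mathbb F_pF$, and in the pro-$p$ case it is the closure of the $n$-th power of the augmentation ideal $\Delta_p$ of the completed group algebra $\mathbb F_p[[F]]$. The presentation is called quasirational if for every $n\ge 1$ and every prime $p$ (in the pro-$p$ case: for every $n\ge1$ and the fixed prime $p$) the abelian group $R/[R,R\mathcal M_n]$ has no nontrivial $p$-torsion; in the pro-$p$ case $[\cdot,\cdot]$ denotes the closed subgroup generated by commutators. Quasirationality does not depend on the choice of the presentation and is a property of the group itself: if $G$ is a discrete group and two presentations of finite type of $G$ are given (possibly with different finite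 generating sets), then one is quasirational if and only if the other is; and if $p$ is a prime, $G$ is a pro-$p$ group and two pro-$p$ presentations of finite type of $G$ are given, then one is quasirational if and only if the other is. Thus if one presentation of finite type of $G$ is quasirational, then so are all the others. -/

import Mathlib

universe u v w

namespace QRat

noncomputable section

/-! ### Subgroups cut out by two-sided ideals -/

section CongruenceSubgroup

variable {A : Type*} [Ring A] {F : Type*} [Group F]

/-- For a homomorphism `φ` from a group `F` to the multiplicative monoid of a ring and a
two-sided ideal `I`, the subgroup of all `f` with `φ f - 1 ∈ I`. -/
def congruenceSubgroup (φ : F →* A) (I : Ideal A) [hI : I.IsTwoSided] : Subgroup F where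
  carrier := {f | φ f - 1 ∈ I}
  one_mem' := by simp
  mul_mem' := by
    intro a b ha hb
    have h : φ (a * b) - 1 = (φ a - 1) * φ b + (φ b - 1) := by
      rw [map_mul]; noncomm_ring
    simp only [Set.mem_ofPred_eq] at ha hb ⊢
    rw [h]
    exact I.add_mem (I.mul_mem_right _ ha) hb
  inv_mem' := by
    intro a ha
    have h : φ a⁻¹ - 1 = -(φ a⁻¹ * (φ a - 1)) := by
      rw [mul_sub, ← map_mul]; simp
    simp only [Set.mem_ofPred_eq] at ha ⊢
    rw [h]
    exact I.neg_mem (I.mul_mem_left _ ha)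

theorem mem_congruenceSubgroup (φ : F →* A) (I : Ideal A) [I.IsTwoSided] (f : F) :
    f ∈ congruenceSubgroup φ I ↔ φ f - 1 ∈ I := Iff.rfl

instance congruenceSubgroup_normal (φ : F →* A) (I : Ideal A) [I.IsTwoSided] :
    (congruenceSubgroup φ I).Normal := by
  refine ⟨fun a ha g => ?_⟩
  rw [mem_congruenceSubgroup] at ha ⊢
  have h : φ (g * a * g⁻¹) - 1 = φ g * (φ a - 1) * φ g⁻¹ := by
    rw [mul_sub, sub_mul, ← map_mul, ← map_mul, mul_one, ← map_mul]; simp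
  rw [h]
  exact I.mul_mem_right _ (I.mul_mem_left _ ha)

instance closure_isTwoSided [TopologicalSpace A] [IsTopologicalRing A] (I : Ideal A)
    [I.IsTwoSided] : I.closure.IsTwoSided := by
  refine ⟨fun {a} b ha => ?_⟩
  have hc : Continuous fun x : A => x * b := continuous_mul_const b
  exact map_mem_closure (f := fun x : A => x * b) (t := (I : Set A)) hc ha fun x hx => I.mul_mem_right b hx

end CongruenceSubgroup

/-! ### The discrete case -/

section Discrete

/-- The augmentation `k[G] → k` of a group ring: the sum of the coefficients. -/
def augmentation (k : Type*) [CommRing k] (G : Type*) [Group G] : MonoidAlgebra k G →+* k :=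
  (MonoidAlgebra.lift k k G (1 : G →* k)).toRingHom

/-- The Zassenhaus `p`-filtration of a (discrete) group `F`:
`M_n = {f | f - 1 ∈ Δ ^ n}`, with `Δ` the augmentation ideal of `𝔽_p[F]`. -/
def zassenhaus (p : ℕ) (F : Type*) [Group F] (n : ℕ) : Subgroup F :=
  congruenceSubgroup (MonoidAlgebra.of (ZMod p) F)
    (RingHom.ker (augmentation (ZMod p) F) ^ n)

instance zassenhaus_normal (p : ℕ) (F : Type*) [Group F] (n : ℕ) :
    (zassenhaus p F n).Normal := by
  unfold zassenhaus; infer_instance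

/-- A homomorphism `π : F(X) → G` from the free group on a finite set is a presentation of `G` of
finite type when it is surjective and its kernel `R` is the normal closure of finitely many
elements. -/
structure IsPresentation {X : Type*} [Finite X] {G : Type*} [Group G]
    (π : FreeGroup X →* G) : Prop where
  surjective : Function.Surjective π
  relations : ∃ S : Set (FreeGroup X), S.Finite ∧ Subgroup.normalClosure S = π.ker

/-- The group `R / [R, R M]` attached to normal subgroups `R`, `M` of `F`. -/
abbrev RelationQuotient {F : Type*} [Group F] (R M : Subgroup F) [R.Normal] [M.Normal] : Type _ :=
  R ⧸ (⁅R, R ⊔ M⁆.subgroupOf R)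

/-- `π : F(X) → G` with kernel `R` is quasirational if for every `n > 0` and every prime `p` the
(abelian) group `R / [R, R M_n]` has no nontrivial `p`-torsion, where `M_n` is the Zassenhaus
`p`-filtration of `F(X)`. -/
def IsQuasirational {X : Type*} {G : Type*} [Group G] (π : FreeGroup X →* G) : Prop :=
  ∀ n : ℕ, 0 < n → ∀ p : ℕ, p.Prime →
    ∀ x : RelationQuotient π.ker (zassenhaus p (FreeGroup X) n),
      ∀ k : ℕ, x ^ p ^ k = 1 → x = 1

end Discrete

/-! ### Pro-`p` groups -/

section ProP

/-- A pro-`p` group: a compact, Hausdorff, totally disconnected topological group all of whose open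
normal subgroups have index a power of `p`. -/
structure IsProP (p : ℕ) (G : Type*) [Group G] [TopologicalSpace G] : Prop where
  isTopologicalGroup : IsTopologicalGroup G
  compactSpace : CompactSpace G
  t2Space : T2Space G
  totallyDisconnectedSpace : TotallyDisconnectedSpace G
  index_eq : ∀ U : OpenNormalSubgroup G, ∃ m : ℕ, (U : Subgroup G).index = p ^ m

/-- The normal subgroups of `Φ` whose index is a (finite) power of `p`. -/
structure PPowerSubgroup (p : ℕ) (Φ : Type u) [Group Φ] : Type u where
  toSubgroup : Subgroup Φ
  normal : toSubgroup.Normal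
  index_eq : ∃ m : ℕ, toSubgroup.index = p ^ m

instance (p : ℕ) (Φ : Type u) [Group Φ] (U : PPowerSubgroup p Φ) : U.toSubgroup.Normal := U.normal

/-- The compatible families in the product of the quotients `Φ / U` over the normal subgroups `U`
of `p`-power index. -/
def proPCompletionSubgroup (p : ℕ) (Φ : Type u) [Group Φ] :
    Subgroup (∀ U : PPowerSubgroup p Φ, Φ ⧸ U.toSubgroup) where
  carrier := {x | ∀ (U V : PPowerSubgroup p Φ) (h : U.toSubgroup ≤ V.toSubgroup),
    QuotientGroup.map U.toSubgroup V.toSubgroup (MonoidHom.id Φ) h (x U) = x V}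
  one_mem' := fun U V h => by simp
  mul_mem' := fun hx hy U V h => by
    rw [Pi.mul_apply, map_mul, hx U V h, hy U V h, Pi.mul_apply]
  inv_mem' := fun hx U V h => by
    rw [Pi.inv_apply, map_inv, hx U V h, Pi.inv_apply]

/-- The pro-`p` completion `lim Φ / U` of a group `Φ`, the limit being taken over the normal
subgroups `U` of `p`-power index. -/
def ProPCompletion (p : ℕ) (Φ : Type u) [Group Φ] : Type u :=
  proPCompletionSubgroup p Φ

instance (p : ℕ) (Φ : Type u) [Group Φ] : Group (ProPCompletion p Φ) :=
  inferInstanceAs (Group (proPCompletionSubgroup p Φ))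

/-- The topology of the projective limit of the discrete groups `Φ / U`. -/
instance (p : ℕ) (Φ : Type u) [Group Φ] : TopologicalSpace (ProPCompletion p Φ) :=
  letI : ∀ U : PPowerSubgroup p Φ, TopologicalSpace (Φ ⧸ U.toSubgroup) := fun _ => ⊥
  inferInstanceAs (TopologicalSpace (proPCompletionSubgroup p Φ))

instance (p : ℕ) (Φ : Type u) [Group Φ] : IsTopologicalGroup (ProPCompletion p Φ) :=
  letI : ∀ U : PPowerSubgroup p Φ, TopologicalSpace (Φ ⧸ U.toSubgroup) := fun _ => ⊥
  haveI : ∀ U : PPowerSubgroup p Φ, DiscreteTopology (Φ ⧸ U.toSubgroup) := fun _ => ⟨rfl⟩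
  inferInstanceAs (IsTopologicalGroup (proPCompletionSubgroup p Φ))

/-- The free pro-`p` group on a finite set `X`. -/
abbrev FreeProP (p : ℕ) (X : Type u) [Finite X] : Type u := ProPCompletion p (FreeGroup X)

/-- The compatible families in the product of the group rings `k[F / U]` over the open normal
subgroups `U` of `F`. -/
def completedGroupAlgebraSubring (k : Type v) [CommRing k] (F : Type u) [Group F]
    [TopologicalSpace F] :
    Subring (∀ U : OpenNormalSubgroup F, MonoidAlgebra k (F ⧸ (U : Subgroup F))) where
  carrier := {x | ∀ (U V : OpenNormalSubgroup F) (h : (U : Subgroup F) ≤ V),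
    MonoidAlgebra.mapDomainRingHom k
      (QuotientGroup.map (U : Subgroup F) (V : Subgroup F) (MonoidHom.id F) h) (x U) = x V}
  one_mem' := fun U V h => by rw [Pi.one_apply, map_one, Pi.one_apply]
  zero_mem' := fun U V h => by rw [Pi.zero_apply, map_zero, Pi.zero_apply]
  add_mem' := fun hx hy U V h => by
    rw [Pi.add_apply, map_add, hx U V h, hy U V h, Pi.add_apply]
  mul_mem' := fun hx hy U V h => by
    rw [Pi.mul_apply, map_mul, hx U V h, hy U V h, Pi.mul_apply]
  neg_mem' := fun hx U V h => by
    rw [Pi.neg_apply, map_neg, hx U V h, Pi.neg_apply]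

/-- The completed group algebra `lim k[F / U]` of a profinite group `F` over a finite (discrete)
ring `k`. -/
def CompletedGroupAlgebra (k : Type v) [CommRing k] (F : Type u) [Group F]
    [TopologicalSpace F] : Type (max u v) :=
  completedGroupAlgebraSubring k F

section CompletedGroupAlgebra

variable (k : Type v) [CommRing k] (F : Type u) [Group F] [TopologicalSpace F]

instance : Ring (CompletedGroupAlgebra k F) :=
  inferInstanceAs (Ring (completedGroupAlgebraSubring k F))

/-- The topology of the projective limit of the discrete rings `k[F / U]`. -/
instance : TopologicalSpace (CompletedGroupAlgebra k F) :=
  letI : ∀ U : OpenNormalSubgroup F,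
    TopologicalSpace (MonoidAlgebra k (F ⧸ (U : Subgroup F))) := fun _ => ⊥
  inferInstanceAs (TopologicalSpace (completedGroupAlgebraSubring k F))

instance : IsTopologicalRing (CompletedGroupAlgebra k F) :=
  letI : ∀ U : OpenNormalSubgroup F,
    TopologicalSpace (MonoidAlgebra k (F ⧸ (U : Subgroup F))) := fun _ => ⊥
  haveI : ∀ U : OpenNormalSubgroup F,
    DiscreteTopology (MonoidAlgebra k (F ⧸ (U : Subgroup F))) := fun _ => ⟨rfl⟩
  inferInstanceAs (IsTopologicalRing (completedGroupAlgebraSubring k F))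

/-- The projection of the completed group algebra to `k[F / U]`. -/
def completedProj (U : OpenNormalSubgroup F) :
    CompletedGroupAlgebra k F →+* MonoidAlgebra k (F ⧸ (U : Subgroup F)) :=
  (Pi.evalRingHom _ U).comp (completedGroupAlgebraSubring k F).subtype

/-- The canonical map `F → k[[F]]`. -/
def completedOf : F →* CompletedGroupAlgebra k F where
  toFun f := ⟨fun U => MonoidAlgebra.of k (F ⧸ (U : Subgroup F)) (QuotientGroup.mk f), by
    intro U V h
    simp only [MonoidAlgebra.of_apply, MonoidAlgebra.mapDomainRingHom_apply,
      MonoidAlgebra.mapDomain_single]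
    rfl⟩
  map_one' := Subtype.ext <| funext fun U => by
    change MonoidAlgebra.of k (F ⧸ (U : Subgroup F)) (QuotientGroup.mk 1) = 1
    rw [QuotientGroup.mk_one, map_one]
  map_mul' f g := Subtype.ext <| funext fun U => by
    change MonoidAlgebra.of k (F ⧸ (U : Subgroup F)) (QuotientGroup.mk (f * g)) =
      MonoidAlgebra.of k (F ⧸ (U : Subgroup F)) (QuotientGroup.mk f) *
        MonoidAlgebra.of k (F ⧸ (U : Subgroup F)) (QuotientGroup.mk g)
    rw [QuotientGroup.mk_mul, map_mul]

/-- The whole group as an open normal subgroup. -/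
def topOpenNormal : OpenNormalSubgroup F where
  toSubgroup := ⊤
  isOpen' := isOpen_univ
  isNormal' := inferInstance

/-- The augmentation `k[[F]] → k`. By compatibility it may be computed at any level `k[F / U]`;
it is defined here through `U = F`. -/
def completedAugmentation : CompletedGroupAlgebra k F →+* k :=
  (augmentation k _).comp (completedProj k F (topOpenNormal F))

theorem completedAugmentation_eq (U : OpenNormalSubgroup F) (x : CompletedGroupAlgebra k F) :
    completedAugmentation k F x = augmentation k _ (completedProj k F U x) := by
  have h := x.2 U (topOpenNormal F) le_top
  have key : (augmentation k (F ⧸ ((topOpenNormal F : OpenNormalSubgroup F) : Subgroup F))).comp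
      (MonoidAlgebra.mapDomainRingHom k
        (QuotientGroup.map (U : Subgroup F) (topOpenNormal F : Subgroup F) (MonoidHom.id F)
          le_top)) = augmentation k (F ⧸ (U : Subgroup F)) := by
    ext <;> simp [augmentation]
  rw [← key]
  change augmentation k _ (x.1 (topOpenNormal F)) = _
  rw [← h]
  rfl

end CompletedGroupAlgebra

/-- The Zassenhaus `p`-filtration of a pro-`p` group `F`: `M_n = {f | f - 1 ∈ Δ ^ n}`, where `Δ` is
the augmentation ideal of `𝔽_p[[F]]` and the `n`-th power is the closed one. -/
def proPZassenhaus (p : ℕ) (F : Type*) [Group F] [TopologicalSpace F] (n : ℕ) : Subgroup F :=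
  congruenceSubgroup (completedOf (ZMod p) F)
    (RingHom.ker (completedAugmentation (ZMod p) F) ^ n).closure

instance proPZassenhaus_normal (p : ℕ) (F : Type*) [Group F] [TopologicalSpace F] (n : ℕ) :
    (proPZassenhaus p F n).Normal := by
  unfold proPZassenhaus; infer_instance

/-- A homomorphism `π : F(X) → G` from the free pro-`p` group on a finite set to a topological group
is a pro-`p` presentation of `G` of finite type when it is continuous and surjective and its kernel
`R` is the closed normal subgroup topologically generated, as such, by finitely many elements. -/
structure IsProPPresentation {p : ℕ} {X : Type*} [Finite X] {G : Type*} [Group G]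
    [TopologicalSpace G] (π : FreeProP p X →* G) : Prop where
  continuous : Continuous π
  surjective : Function.Surjective π
  relations : ∃ S : Set (FreeProP p X), S.Finite ∧
    (Subgroup.normalClosure S).topologicalClosure = π.ker

/-- The closed commutator subgroup of two normal subgroups is normal. -/
instance closedCommutator_normal {F : Type*} [Group F] [TopologicalSpace F] [IsTopologicalGroup F]
    (R N : Subgroup F) [R.Normal] [N.Normal] : (⁅R, N⁆.topologicalClosure).Normal :=
  Subgroup.is_normal_topologicalClosure _

/-- The group `R / [R, R M]` attached to normal subgroups `R`, `M` of a topological group `F`,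
where `[R, R M]` is the closed subgroup generated by the commutators. -/
abbrev ProPRelationQuotient {F : Type*} [Group F] [TopologicalSpace F] [IsTopologicalGroup F]
    (R M : Subgroup F) [R.Normal] [M.Normal] : Type _ :=
  R ⧸ (⁅R, R ⊔ M⁆.topologicalClosure.subgroupOf R)

/-- `π : F(X) → G` with kernel `R` is quasirational if for every `n > 0` the (abelian) group
`R / [R, R M_n]` has no nontrivial `p`-torsion, where `M_n` is the Zassenhaus `p`-filtration of the
free pro-`p` group `F(X)`. -/
def IsProPQuasirational {p : ℕ} {X : Type*} [Finite X] {G : Type*} [Group G]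
    (π : FreeProP p X →* G) : Prop :=
  ∀ n : ℕ, 0 < n →
    ∀ x : ProPRelationQuotient π.ker (proPZassenhaus p (FreeProP p X) n),
      ∀ k : ℕ, x ^ p ^ k = 1 → x = 1

end ProP

end

end QRat

namespace QRat

/-! ### Commutators in free groups and under endomorphisms -/

section Group

open Subgroup
open scoped commutatorElement

/-! Let `π` and `ρ` present `G`, with kernels `R` and `R'`. Freeness gives lifts `f` and `g` of the
identity of `G` between the two free groups. Both carry kernels to kernels and, by functoriality of
group rings, Zassenhaus terms to Zassenhaus terms, hence `[R, R M]` into `[R', R' M']` and back. So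
if a `p`-power of `x ∈ R` lies in `[R, R M]` and `ρ` is quasirational, then `g (f x) ∈ [R, R M]`.

It remains to compare `x` with `g (f x)`. Put `H = R M`. The `p`-power of `x` lies in `[H, H]`, and
the abelianization of `H` has no `p`-torsion, so `x ∈ [H, H]`. Since `g ∘ f` covers the identity of
`G`, it changes elements only by factors in `R`, and therefore fixes `[H, H]` modulo `[R, H]`
(`inv_mul_map_mem_of_mem_commutator`). Thus `x ≡ g (f x) ≡ 1`.

For discrete groups, `H` is free by Nielsen–Schreier. In the pro-`p` case commutator subgroups are
replaced by their closures, and the absence of torsion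
(`ProPCompletion.mem_closure_commutator_of_pow_mem`) is reduced to subgroups of the dense abstract
free group by approximation at finite levels. -/

theorem isMulTorsionFree_abelianization_of_isFreeGroup (V : Type u) [Group V] [IsFreeGroup V] :
    IsMulTorsionFree (Abelianization V) := by
  refine ⟨fun n hn a b hab => ?_⟩
  let e : Abelianization V ≃* Abelianization (FreeGroup (IsFreeGroup.Generators V)) :=
    (IsFreeGroup.toFreeGroup V).abelianizationCongr
  let f : FreeAbelianGroup (IsFreeGroup.Generators V) ≃+ (IsFreeGroup.Generators V →₀ ℤ) :=
    FreeAbelianGroup.equivFinsupp _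
  -- `FreeAbelianGroup` is by definition the additive form of this abelianization, so `f` is only
  -- retyped.
  let f' : Additive (Abelianization (FreeGroup (IsFreeGroup.Generators V))) ≃+
    (IsFreeGroup.Generators V →₀ ℤ) := f
  have h : n • f' (Additive.ofMul (e a)) = n • f' (Additive.ofMul (e b)) := by
    rw [← map_nsmul f', ← map_nsmul f', ← ofMul_pow, ← ofMul_pow, ← map_pow, ← map_pow]
    exact congrArg (fun t => f' (Additive.ofMul (e t))) hab
  have h2 := nsmul_right_injective hn h
  exact e.injective (Additive.ofMul.injective (f'.injective h2))

theorem mem_commutator_subgroup_iff {F : Type u} [Group F] (V : Subgroup F) (x : V) :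
    (x : F) ∈ ⁅V, V⁆ ↔ Abelianization.of x = 1 := by
  rw [← MonoidHom.mem_ker, Abelianization.ker_of, ← map_subtype_commutator]
  simp

/-- Extraction of `a`-th roots in the abelianization of `V`, which is torsion-free because `V` is
free by Nielsen–Schreier. The factor `y` makes the lemma usable when `x ^ a` is known only modulo
`[V, V]` and high powers. -/
theorem mul_inv_pow_mem_commutator_of_isFreeGroup {F : Type u} [Group F] [IsFreeGroup F]
    (V : Subgroup F) {x y : F} (hx : x ∈ V) (hy : y ∈ V) {a b : ℕ} (ha : a ≠ 0)
    (h : x ^ a * (y ^ (b * a))⁻¹ ∈ ⁅V, V⁆) : x * (y ^ b)⁻¹ ∈ ⁅V, V⁆ := by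
  have := isMulTorsionFree_abelianization_of_isFreeGroup V
  lift x to V using hx
  lift y to V using hy
  have h1 := (mem_commutator_subgroup_iff V (x ^ a * (y ^ (b * a))⁻¹)).1 (by simpa using h)
  have h2 := (mem_commutator_subgroup_iff V (x * (y ^ b)⁻¹)).2 ?_
  · simpa using h2
  · rw [map_mul, map_inv, map_pow, map_pow, pow_mul, ← inv_pow, ← mul_pow] at h1
    rw [map_mul, map_inv, map_pow]
    exact (pow_eq_one_iff_left ha).1 h1

theorem mem_commutator_of_pow_mem_of_isFreeGroup {F : Type u} [Group F] [IsFreeGroup F]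
    (V : Subgroup F) {x : F} (hx : x ∈ V) {a : ℕ} (ha : a ≠ 0)
    (h : x ^ a ∈ ⁅V, V⁆) : x ∈ ⁅V, V⁆ := by
  have := mul_inv_pow_mem_commutator_of_isFreeGroup V hx V.one_mem (b := 1) ha (by simpa using h)
  simpa using this

/-- The subgroup `[V, V] V ^ N` of a group, for a subgroup `V`. -/
def commutatorPow {F : Type u} [Group F] (V : Subgroup F) (N : ℕ) : Subgroup F :=
  ((powMonoidHom N : Abelianization V →* Abelianization V).range.comap Abelianization.of).map
    V.subtype

theorem mem_commutatorPow {F : Type u} [Group F] {V : Subgroup F} {N : ℕ} {x : F} :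
    x ∈ commutatorPow V N ↔ x ∈ V ∧ ∃ y ∈ V, x * (y ^ N)⁻¹ ∈ ⁅V, V⁆ := by
  have key : ∀ x y : V, (x : F) * ((y : F) ^ N)⁻¹ ∈ ⁅V, V⁆ ↔
      Abelianization.of y ^ N = Abelianization.of x := fun x y => by
    have := mem_commutator_subgroup_iff V (x * (y ^ N)⁻¹)
    rw [map_mul, map_inv, map_pow, mul_inv_eq_one] at this
    simpa [eq_comm] using this
  constructor
  · rintro ⟨x, ⟨y, hy⟩, rfl⟩
    obtain ⟨y, rfl⟩ := QuotientGroup.mk_surjective y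
    exact ⟨x.2, y, y.2, (key x y).2 hy⟩
  · rintro ⟨hx, y, hy, h⟩
    exact ⟨⟨x, hx⟩, ⟨Abelianization.of ⟨y, hy⟩, (key ⟨x, hx⟩ ⟨y, hy⟩).1 h⟩, rfl⟩

theorem commutator_le_commutatorPow {F : Type u} [Group F] (V : Subgroup F) (N : ℕ) :
    ⁅V, V⁆ ≤ commutatorPow V N := fun x hx =>
  mem_commutatorPow.2 ⟨commutator_le_self V hx, 1, V.one_mem, by simpa using hx⟩

instance commutatorPow_normal {F : Type u} [Group F] (V : Subgroup F) [hV : V.Normal] (N : ℕ) :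
    (commutatorPow V N).Normal := by
  refine ⟨fun x hx g => ?_⟩
  obtain ⟨h1, y, hy, h⟩ := mem_commutatorPow.1 hx
  refine mem_commutatorPow.2 ⟨hV.conj_mem _ h1 g, g * y * g⁻¹, hV.conj_mem _ hy g, ?_⟩
  have := (commutator_normal V V).conj_mem _ h g
  rw [conj_pow]
  convert this using 1
  group

/-- Having finite index, `V` is finitely generated, so its abelianization modulo `p ^ N`-th powers
is a finitely generated abelian group of `p`-power exponent, hence a finite `p`-group. -/
theorem exists_index_commutatorPow_eq {F : Type u} [Group F] [Group.FG F] (p : ℕ)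
    [Fact p.Prime] (V : Subgroup F) (hV : ∃ m, V.index = p ^ m) (N : ℕ) :
    ∃ m, (commutatorPow V (p ^ N)).index = p ^ m := by
  obtain ⟨m, hm⟩ := hV
  have hp := (Fact.out : p.Prime)
  have : V.FiniteIndex := ⟨by rw [hm]; exact pow_ne_zero _ hp.ne_zero⟩
  have : Group.FG V := inferInstance
  have : Group.FG (Abelianization V) :=
    Group.fg_of_surjective (f := Abelianization.of) QuotientGroup.mk_surjective
  let P := (powMonoidHom (p ^ N) : Abelianization V →* Abelianization V).range
  have hpow : ∀ g : Abelianization V ⧸ P, g ^ p ^ N = 1 := fun g => by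
    obtain ⟨g, rfl⟩ := QuotientGroup.mk_surjective g
    rw [← QuotientGroup.mk_pow, QuotientGroup.eq_one_iff]
    exact ⟨g, rfl⟩
  have : Finite (Abelianization V ⧸ P) := CommGroup.finite_of_fg_isMulTorsion _ fun g =>
    isOfFinOrder_iff_pow_eq_one.2 ⟨p ^ N, pow_pos hp.pos _, hpow g⟩
  obtain ⟨n, hn⟩ := (IsPGroup.iff_card (p := p)).1 fun g : Abelianization V ⧸ P => ⟨N, hpow g⟩
  refine ⟨n + m, ?_⟩
  rw [commutatorPow, index_map_subtype, hm,
    index_comap_of_surjective _ QuotientGroup.mk_surjective, pow_add]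
  exact congrArg (· * p ^ m) hn

/-- An endomorphism that moves the elements of `H` by elements of `R` only acts trivially on
`[H, H]` modulo `[R, H]`. -/
theorem inv_mul_map_mem_of_mem_commutator {F : Type u} [Group F] {R H C : Subgroup F} [C.Normal]
    (hRH : R ≤ H) (hC : ⁅R, H⁆ ≤ C) (φ : F →* F) (hφ : ∀ h ∈ H, h⁻¹ * φ h ∈ R)
    {y : F} (hy : y ∈ ⁅H, H⁆) : y⁻¹ * φ y ∈ C := by
  let q := QuotientGroup.mk' C
  have hcomm : ∀ r ∈ R, ∀ h ∈ H, Commute (q r) (q h) := fun r hr h hh => by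
    rw [← commutatorElement_eq_one_iff_commute (G := F ⧸ C), ← map_commutatorElement]
    exact (QuotientGroup.eq_one_iff _).2 (hC (commutator_mem_commutator hr hh))
  -- The elements on which `φ` is trivial modulo `C` form a subgroup, so generating commutators
  -- suffice.
  suffices ⁅H, H⁆ ≤ q.eqLocus (q.comp φ) from QuotientGroup.eq.1 (this hy)
  rw [commutator_le]
  intro a ha b hb
  change q _ = q (φ _)
  obtain ⟨r, hr, hra⟩ : ∃ r ∈ R, φ a = a * r := ⟨_, hφ a ha, by group⟩
  obtain ⟨s, hs, hsb⟩ : ∃ s ∈ R, φ b = b * s := ⟨_, hφ b hb, by group⟩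
  have h2 := hcomm r hr b hb
  have h3 := hcomm s hs a ha
  -- Modulo `C`, `r` commutes with `b` and `s`, and `s` commutes with `a`; this removes `r` and `s`
  -- from the commutator one at a time.
  have h5 := hcomm r hr s (hRH hs)
  simp only [map_commutatorElement, hra, hsb, map_mul]
  have e1 : ⁅q a * q r, q b * q s⁆ = ⁅q a, q b * q s⁆ := by
    rw [commutatorElement_mul_left_eq_conj_mul,
      commutatorElement_eq_one_iff_commute.2 (h2.mul_right h5)]
    simp
  have e2 : ⁅q a, q b * q s⁆ = ⁅q a, q b⁆ := by
    rw [commutatorElement_mul_right_eq_mul_conj,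
      commutatorElement_eq_one_iff_commute.2 h3.symm]
    simp
  rw [e1, e2]

end Group

/-! ### Functoriality and the discrete case -/

section Discrete

open Subgroup

theorem pow_le_comap_pow {A B : Type*} [Ring A] [Ring B] {I : Ideal A} {J : Ideal B}
    (f : A →+* B) (h : I ≤ J.comap f) (n : ℕ) : I ^ n ≤ (J ^ n).comap f := by
  induction n with
  | zero =>
    have h1 : (J ^ 0).comap f = ⊤ := (Ideal.eq_top_iff_one _).2 (by
      rw [Ideal.mem_comap, map_one, Submodule.pow_zero]; exact Submodule.one_le.1 le_rfl)
    rw [h1]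
    exact le_top
  | succ n ih =>
    rw [Submodule.pow_succ, Submodule.pow_succ, Submodule.mul_le]
    intro a ha b hb
    rw [Ideal.mem_comap, map_mul]
    exact Submodule.mul_mem_mul (ih ha) (h hb)

theorem augmentation_mapDomainRingHom (k : Type*) [CommRing k] {F F' : Type*} [Group F] [Group F']
    (f : F →* F') (x : MonoidAlgebra k F) :
    augmentation k F' (MonoidAlgebra.mapDomainRingHom k f x) = augmentation k F x := by
  have : (augmentation k F').comp (MonoidAlgebra.mapDomainRingHom k f) = augmentation k F := by
    ext <;> simp [augmentation]
  exact DFunLike.congr_fun this x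

theorem zassenhaus_le_comap (p : ℕ) {F F' : Type*} [Group F] [Group F'] (f : F →* F') (n : ℕ) :
    zassenhaus p F n ≤ (zassenhaus p F' n).comap f := by
  intro a ha
  have h := pow_le_comap_pow (I := RingHom.ker (augmentation (ZMod p) F))
    (J := RingHom.ker (augmentation (ZMod p) F')) (MonoidAlgebra.mapDomainRingHom (ZMod p) f)
    (fun x hx => by
      rw [Ideal.mem_comap, RingHom.mem_ker, augmentation_mapDomainRingHom]; exact hx) n ha
  rw [Ideal.mem_comap, map_sub, map_one] at h
  change MonoidAlgebra.of (ZMod p) F' (f a) - 1 ∈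
    RingHom.ker (augmentation (ZMod p) F') ^ n
  convert h using 2
  simp

theorem sup_le_comap_sup {F F' : Type*} [Group F] [Group F'] {R M : Subgroup F}
    {R' M' : Subgroup F'} {f : F →* F'} (hR : R ≤ R'.comap f) (hM : M ≤ M'.comap f) :
    R ⊔ M ≤ (R' ⊔ M').comap f :=
  sup_le (hR.trans (comap_mono le_sup_left)) (hM.trans (comap_mono le_sup_right))

theorem commutator_le_comap {F F' : Type*} [Group F] [Group F'] {R H : Subgroup F}
    {R' H' : Subgroup F'} {f : F →* F'} (hR : R ≤ R'.comap f) (hH : H ≤ H'.comap f) :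
    ⁅R, H⁆ ≤ ⁅R', H'⁆.comap f := by
  rw [commutator_le]
  intro a ha b hb
  rw [mem_comap, map_commutatorElement]
  exact commutator_mem_commutator (hR ha) (hH hb)

theorem ker_le_comap_ker {F F' G : Type*} [Group F] [Group F'] [Group G] {π : F →* G}
    {ρ : F' →* G} {f : F →* F'} (hf : ∀ x, ρ (f x) = π x) : π.ker ≤ ρ.ker.comap f := fun x hx => by
  rw [mem_comap, MonoidHom.mem_ker, hf]; exact hx

/-- Having no `p`-torsion in `R / C`, expressed through elements of `R`. -/
theorem quotient_torsion_iff {F : Type*} [Group F] {R C : Subgroup F} [C.Normal] (p : ℕ) :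
    (∀ x : R ⧸ C.subgroupOf R, ∀ k : ℕ, x ^ p ^ k = 1 → x = 1) ↔
      ∀ x ∈ R, ∀ k : ℕ, x ^ p ^ k ∈ C → x ∈ C := by
  constructor
  · intro h x hx k hk
    have := h (QuotientGroup.mk ⟨x, hx⟩) k
    rw [← QuotientGroup.mk_pow, QuotientGroup.eq_one_iff, QuotientGroup.eq_one_iff,
      mem_subgroupOf, mem_subgroupOf] at this
    exact this hk
  · intro h x k hk
    obtain ⟨x, rfl⟩ := QuotientGroup.mk_surjective x
    rw [← QuotientGroup.mk_pow, QuotientGroup.eq_one_iff, mem_subgroupOf] at hk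
    rw [QuotientGroup.eq_one_iff, mem_subgroupOf]
    exact h x x.2 k hk

theorem FreeGroup.exists_lift_of_surjective {X : Type*} {F' G : Type*} [Group F'] [Group G]
    (π : FreeGroup X →* G) {ρ : F' →* G} (hρ : Function.Surjective ρ) :
    ∃ f : FreeGroup X →* F', ∀ x, ρ (f x) = π x := by
  choose s hs using fun x => hρ (π (FreeGroup.of x))
  refine ⟨FreeGroup.lift s, fun x => ?_⟩
  have : ρ.comp (FreeGroup.lift s) = π := FreeGroup.ext_hom _ _ fun x => by simp [hs]
  exact DFunLike.congr_fun this x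

theorem isQuasirational_of_surjective {X Y G : Type*} [Group G] {π : FreeGroup X →* G}
    {ρ : FreeGroup Y →* G} (hπ : Function.Surjective π) (hρ : Function.Surjective ρ)
    (h : IsQuasirational ρ) : IsQuasirational π := by
  intro n hn p hp
  obtain ⟨f, hf⟩ := FreeGroup.exists_lift_of_surjective π hρ
  obtain ⟨g, hg⟩ := FreeGroup.exists_lift_of_surjective ρ hπ
  have h' := (quotient_torsion_iff p).1 (h n hn p hp)
  refine (quotient_torsion_iff p).2 fun x hx k hk => ?_
  have hRf := ker_le_comap_ker hf
  have hRg := ker_le_comap_ker hg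
  have hf1 := h' (f x) (hRf hx) k (by
    rw [← map_pow]
    exact commutator_le_comap hRf (sup_le_comap_sup hRf (zassenhaus_le_comap p f n)) hk)
  have hg1 : g (f x) ∈ ⁅π.ker, π.ker ⊔ zassenhaus p _ n⁆ :=
    commutator_le_comap hRg (sup_le_comap_sup hRg (zassenhaus_le_comap p g n)) hf1
  -- Enlarging `[R, R M]` to `[R M, R M]` makes torsion-freeness of a free abelianization available.
  have hx' : x ∈ ⁅π.ker ⊔ zassenhaus p _ n, π.ker ⊔ zassenhaus p _ n⁆ :=
    mem_commutator_of_pow_mem_of_isFreeGroup _ (le_sup_left (a := π.ker) hx)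
      (pow_ne_zero k hp.ne_zero) (commutator_mono le_sup_left le_rfl hk)
  -- `g ∘ f` covers the identity of `G`, so it moves every element by a factor in `π.ker`.
  have key := inv_mul_map_mem_of_mem_commutator (R := π.ker) le_sup_left le_rfl (g.comp f)
    (fun y _ => by simp [MonoidHom.mem_ker, hg, hf]) hx'
  have := mul_mem hg1 (inv_mem key)
  simpa using this

end Discrete

end QRat

namespace QRat

/-! ### Functoriality of the completed group algebra -/

section CompletedGroupAlgebra

open Subgroup

/-- The preimage of an open normal subgroup under a continuous homomorphism. -/
def openNormalComap {F F' : Type*} [Group F] [TopologicalSpace F] [Group F'] [TopologicalSpace F']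
    (f : F →* F') (hf : Continuous f) (V : OpenNormalSubgroup F') : OpenNormalSubgroup F where
  toSubgroup := (V : Subgroup F').comap f
  isOpen' := V.isOpen'.preimage hf
  isNormal' := inferInstance

variable (k : Type*) [CommRing k] {F F' : Type*} [Group F] [TopologicalSpace F] [Group F']
  [TopologicalSpace F'] (f : F →* F') (hf : Continuous f)

theorem mapDomainRingHom_comp_apply {A B C : Type*} [Monoid A] [Monoid B] [Monoid C] (g : B →* C)
    (h : A →* B) (x : MonoidAlgebra k A) :
    MonoidAlgebra.mapDomainRingHom k g (MonoidAlgebra.mapDomainRingHom k h x) =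
      MonoidAlgebra.mapDomainRingHom k (g.comp h) x := by
  have : (MonoidAlgebra.mapDomainRingHom k g).comp (MonoidAlgebra.mapDomainRingHom k h) =
      MonoidAlgebra.mapDomainRingHom k (g.comp h) := by
    ext <;> simp
  exact DFunLike.congr_fun this x

/-- The map from `F / f⁻¹ V` to `F' / V` induced by a continuous homomorphism `f`. -/
def openNormalQuotientMap (V : OpenNormalSubgroup F') :
    F ⧸ (openNormalComap f hf V : Subgroup F) →* F' ⧸ (V : Subgroup F') :=
  QuotientGroup.map _ _ f le_rfl

/-- The ring homomorphism of completed group algebras induced by a continuous homomorphism. -/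
noncomputable def completedMap : CompletedGroupAlgebra k F →+* CompletedGroupAlgebra k F' :=
  ((RingHom.pi fun V : OpenNormalSubgroup F' =>
    (MonoidAlgebra.mapDomainRingHom k (openNormalQuotientMap f hf V)).comp
      (completedProj k F (openNormalComap f hf V))).codRestrict
    (completedGroupAlgebraSubring k F') fun x U V h => by
      have hc := x.2 (openNormalComap f hf U) (openNormalComap f hf V) (comap_mono h)
      change MonoidAlgebra.mapDomainRingHom k _ (MonoidAlgebra.mapDomainRingHom k _ (x.1 _)) =
        MonoidAlgebra.mapDomainRingHom k _ (x.1 (openNormalComap f hf V))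
      rw [← hc]
      rw [mapDomainRingHom_comp_apply, mapDomainRingHom_comp_apply]
      congr 2
      ext g
      rfl)

theorem continuous_completedMap : Continuous (completedMap k f hf) := by
  let _ : ∀ U : OpenNormalSubgroup F,
    TopologicalSpace (MonoidAlgebra k (F ⧸ (U : Subgroup F))) := fun _ => ⊥
  have _ : ∀ U : OpenNormalSubgroup F,
    DiscreteTopology (MonoidAlgebra k (F ⧸ (U : Subgroup F))) := fun _ => ⟨rfl⟩
  let _ : ∀ U : OpenNormalSubgroup F',
    TopologicalSpace (MonoidAlgebra k (F' ⧸ (U : Subgroup F'))) := fun _ => ⊥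
  refine Continuous.subtype_mk (continuous_pi fun V => ?_) _
  exact (continuous_of_discreteTopology
    (f := MonoidAlgebra.mapDomainRingHom k (openNormalQuotientMap f hf V))).comp
    ((continuous_apply (openNormalComap f hf V)).comp continuous_subtype_val)

theorem completedMap_completedOf (a : F) :
    completedMap k f hf (completedOf k F a) = completedOf k F' (f a) := by
  refine Subtype.ext (funext fun V => ?_)
  change MonoidAlgebra.mapDomainRingHom k (openNormalQuotientMap f hf V)
    (MonoidAlgebra.of k _ _) = MonoidAlgebra.of k _ _
  simp
  rfl

theorem completedAugmentation_completedMap (x : CompletedGroupAlgebra k F) :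
    completedAugmentation k F' (completedMap k f hf x) = completedAugmentation k F x := by
  -- The source augmentation is computed at the level from which `completedMap` builds its top
  -- component.
  rw [completedAugmentation_eq k F (openNormalComap f hf (topOpenNormal F'))]
  exact augmentation_mapDomainRingHom k _ _

/-- The induced map of completed group algebras preserves the augmentation, hence powers of its
kernel; continuity extends this to their closures. -/
theorem proPZassenhaus_le_comap {F F' : Type*} [Group F] [TopologicalSpace F] [Group F']
    [TopologicalSpace F'] (f : F →* F') (hf : Continuous f) (p n : ℕ) :
    proPZassenhaus p F n ≤ (proPZassenhaus p F' n).comap f := by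
  intro a ha
  have h := map_mem_closure (continuous_completedMap (ZMod p) f hf) ha
    (t := (RingHom.ker (completedAugmentation (ZMod p) F') ^ n : Ideal _))
    (pow_le_comap_pow (completedMap (ZMod p) f hf) (fun x hx => by
      rw [Ideal.mem_comap, RingHom.mem_ker, completedAugmentation_completedMap]; exact hx) n)
  rwa [map_sub, map_one, completedMap_completedOf] at h

end CompletedGroupAlgebra

/-! ### Pro-`p` completions and torsion in abelianizations -/

section ProPCompletion

open Subgroup
open scoped commutatorElement

variable {p : ℕ} {Φ : Type u} [Group Φ] {Ψ : Type v} [Group Ψ]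

/-- The kernel of a homomorphism to a group of `p`-power order. -/
def PPowerSubgroup.ofKer [Fact p.Prime] {Q : Type*} [Group Q] (f : Φ →* Q)
    (hQ : ∃ m, Nat.card Q = p ^ m) : PPowerSubgroup p Φ where
  toSubgroup := f.ker
  normal := inferInstance
  index_eq := by
    obtain ⟨m, hm⟩ := hQ
    obtain ⟨n, -, hn⟩ := (Nat.dvd_prime_pow (Fact.out : p.Prime)).1
      (hm ▸ index_ker f ▸ card_subgroup_dvd_card f.range)
    exact ⟨n, hn⟩

theorem PPowerSubgroup.exists_le_inf [Fact p.Prime] (U V : PPowerSubgroup p Φ) :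
    ∃ W : PPowerSubgroup p Φ, W.toSubgroup ≤ U.toSubgroup ∧ W.toSubgroup ≤ V.toSubgroup := by
  obtain ⟨a, ha⟩ := U.index_eq
  obtain ⟨b, hb⟩ := V.index_eq
  refine ⟨.ofKer ((QuotientGroup.mk' U.toSubgroup).prod (QuotientGroup.mk' V.toSubgroup))
    ⟨a + b, ?_⟩, fun x hx => ?_, fun x hx => ?_⟩
  · rw [Nat.card_prod, ← index_eq_card, ← index_eq_card, ha, hb, pow_add]
  · exact (QuotientGroup.eq_one_iff x).1 (congrArg Prod.fst (MonoidHom.mem_ker.1 hx))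
  · exact (QuotientGroup.eq_one_iff x).1 (congrArg Prod.snd (MonoidHom.mem_ker.1 hx))

theorem PPowerSubgroup.exists_le_finset [Fact p.Prime] (I : Finset (PPowerSubgroup p Φ)) :
    ∃ W : PPowerSubgroup p Φ, ∀ U ∈ I, W.toSubgroup ≤ U.toSubgroup := by
  classical
  induction I using Finset.induction_on with
  | empty => exact ⟨⟨⊤, inferInstance, 0, by simp⟩, by simp⟩
  | insert U I _ ih =>
    obtain ⟨W, hW⟩ := ih
    obtain ⟨T, hTU, hTW⟩ := U.exists_le_inf W
    refine ⟨T, fun V hV => ?_⟩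
    rcases Finset.mem_insert.1 hV with rfl | hV
    · exact hTU
    · exact hTW.trans (hW V hV)

variable (p) in
/-- The canonical homomorphism from a group to its pro-`p` completion. -/
def ProPCompletion.of : Φ →* ProPCompletion p Φ where
  toFun g := ⟨fun _ => QuotientGroup.mk g, fun _ _ _ => rfl⟩
  map_one' := rfl
  map_mul' _ _ := rfl

/-- The projection of the pro-`p` completion to `Φ / U`. -/
def ProPCompletion.proj (U : PPowerSubgroup p Φ) : ProPCompletion p Φ →* Φ ⧸ U.toSubgroup where
  toFun x := x.1 U
  map_one' := rfl
  map_mul' _ _ := rfl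

namespace ProPCompletion

@[simp]
theorem proj_of (U : PPowerSubgroup p Φ) (g : Φ) : proj U (of p g) = QuotientGroup.mk g := rfl

theorem proj_eq_map {U V : PPowerSubgroup p Φ} (h : U.toSubgroup ≤ V.toSubgroup)
    (x : ProPCompletion p Φ) :
    proj V x = QuotientGroup.map U.toSubgroup V.toSubgroup (MonoidHom.id Φ) h (proj U x) :=
  (x.2 U V h).symm

theorem proj_eq_mk_of_le {U V : PPowerSubgroup p Φ} (h : U.toSubgroup ≤ V.toSubgroup)
    {x : ProPCompletion p Φ} {g : Φ} (hx : proj U x = QuotientGroup.mk g) :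
    proj V x = QuotientGroup.mk g := by
  rw [proj_eq_map h, hx]; rfl

theorem proj_surjective (U : PPowerSubgroup p Φ) : Function.Surjective (proj U) := fun q => by
  obtain ⟨g, rfl⟩ := QuotientGroup.mk_surjective q
  exact ⟨of p g, rfl⟩

theorem isOpen_setOf_proj_eq (U : PPowerSubgroup p Φ) (q : Φ ⧸ U.toSubgroup) :
    IsOpen {x : ProPCompletion p Φ | proj U x = q} := by
  let _ : ∀ U : PPowerSubgroup p Φ, TopologicalSpace (Φ ⧸ U.toSubgroup) := fun _ => ⊥
  have _ : ∀ U : PPowerSubgroup p Φ, DiscreteTopology (Φ ⧸ U.toSubgroup) := fun _ => ⟨rfl⟩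
  have h : Continuous fun x : ProPCompletion p Φ => proj U x :=
    (continuous_apply U).comp continuous_subtype_val
  exact (isOpen_discrete {q}).preimage h

/-- A basic open set constrains finitely many coordinates, and one sufficiently small subgroup of
`p`-power index controls them all. -/
theorem exists_proj_subset_of_mem_isOpen [Fact p.Prime] {O : Set (ProPCompletion p Φ)}
    (hO : IsOpen O) {x : ProPCompletion p Φ} (hx : x ∈ O) :
    ∃ U : PPowerSubgroup p Φ, ∀ y, proj U y = proj U x → y ∈ O := by
  let _ : ∀ U : PPowerSubgroup p Φ, TopologicalSpace (Φ ⧸ U.toSubgroup) := fun _ => ⊥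
  obtain ⟨O', hO', rfl⟩ := isOpen_induced_iff.1 hO
  obtain ⟨I, u, hu, hI⟩ := isOpen_pi_iff.1 hO' _ hx
  obtain ⟨W, hW⟩ := PPowerSubgroup.exists_le_finset I
  refine ⟨W, fun y hy => hI fun V hV => ?_⟩
  have : proj V y = proj V x := by rw [proj_eq_map (hW V hV), proj_eq_map (hW V hV), hy]
  change proj V y ∈ u V
  rw [this]
  exact (hu V hV).2

theorem mem_closure_iff_proj [Fact p.Prime] {S : Set (ProPCompletion p Φ)}
    {x : ProPCompletion p Φ} :
    x ∈ _root_.closure S ↔ ∀ U : PPowerSubgroup p Φ, ∃ y ∈ S, proj U y = proj U x := by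
  rw [mem_closure_iff]
  constructor
  · intro h U
    obtain ⟨y, hy, hyS⟩ := h _ (isOpen_setOf_proj_eq U (proj U x)) rfl
    exact ⟨y, hyS, hy⟩
  · intro h O hO hx
    obtain ⟨U, hU⟩ := exists_proj_subset_of_mem_isOpen hO hx
    obtain ⟨y, hyS, hy⟩ := h U
    exact ⟨y, hU y hy, hyS⟩

theorem denseRange_of [Fact p.Prime] : DenseRange (of p : Φ →* ProPCompletion p Φ) := fun x =>
  mem_closure_iff_proj.2 fun U => by
    obtain ⟨g, hg⟩ := QuotientGroup.mk_surjective (proj U x)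
    exact ⟨_, ⟨g, rfl⟩, hg⟩

section Lift

variable [Fact p.Prime] (θ : Φ →* ProPCompletion p Ψ)

/-- The preimage of `V` under a homomorphism to the pro-`p` completion. -/
def pullback (V : PPowerSubgroup p Ψ) : PPowerSubgroup p Φ :=
  .ofKer ((proj V).comp θ) V.index_eq

/-- The continuous extension of a homomorphism `Φ → lim Ψ / V` to the pro-`p` completion. -/
def lift : ProPCompletion p Φ →* ProPCompletion p Ψ where
  -- The map `Φ → Ψ / V` has a kernel of `p`-power index, so its value at `x` can be read off one
  -- coordinate of `x`.
  toFun x := ⟨fun V => QuotientGroup.kerLift ((proj V).comp θ) (proj (pullback θ V) x),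
    fun U V h => by
      have hle : (pullback θ U).toSubgroup ≤ (pullback θ V).toSubgroup := fun g hg => by
        change proj V (θ g) = 1
        rw [proj_eq_map h, show proj U (θ g) = 1 from hg, map_one]
      obtain ⟨g, hg⟩ := QuotientGroup.mk_surjective (proj (pullback θ U) x)
      have hg' := proj_eq_mk_of_le hle hg.symm
      beta_reduce
      rw [hg', ← hg]
      exact (proj_eq_map h (θ g)).symm⟩
  map_one' := Subtype.ext <| funext fun V => by
    change QuotientGroup.kerLift ((proj V).comp θ) (proj (pullback θ V) 1) = 1
    rw [map_one]
    exact map_one _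
  map_mul' x y := Subtype.ext <| funext fun V => by
    change QuotientGroup.kerLift ((proj V).comp θ) (proj (pullback θ V) (x * y)) = _
    rw [map_mul]
    exact map_mul _ _ _

@[simp]
theorem lift_of (g : Φ) : lift θ (of p g) = θ g := rfl

theorem continuous_lift : Continuous (lift θ) := by
  let _ : ∀ U : PPowerSubgroup p Φ, TopologicalSpace (Φ ⧸ U.toSubgroup) := fun _ => ⊥
  have _ : ∀ U : PPowerSubgroup p Φ, DiscreteTopology (Φ ⧸ U.toSubgroup) := fun _ => ⟨rfl⟩
  let _ : ∀ U : PPowerSubgroup p Ψ, TopologicalSpace (Ψ ⧸ U.toSubgroup) := fun _ => ⊥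
  refine Continuous.subtype_mk (continuous_pi fun V => ?_) _
  have h : Continuous fun x : ProPCompletion p Φ => proj (pullback θ V) x :=
    (continuous_apply (pullback θ V)).comp continuous_subtype_val
  exact (continuous_of_discreteTopology
    (f := fun q : Φ ⧸ (pullback θ V).toSubgroup =>
      QuotientGroup.kerLift ((proj V).comp θ) q)).comp h

end Lift

/-- The abelianization of a normal subgroup of the pro-`p` completion of a finitely generated free
group has no `p`-torsion. -/
theorem mem_closure_commutator_of_pow_mem [Fact p.Prime] [IsFreeGroup Φ] [Group.FG Φ]
    (H : Subgroup (ProPCompletion p Φ)) [H.Normal] {x : ProPCompletion p Φ} (hx : x ∈ H) {k : ℕ}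
    (h : x ^ p ^ k ∈ ⁅H, H⁆.topologicalClosure) : x ∈ ⁅H, H⁆.topologicalClosure := by
  have hp := (Fact.out : p.Prime)
  -- Closure membership is tested at each level `U`, where `H` is replaced by the subgroup `V` of
  -- `Φ` with the same image in `Φ / U`.
  refine (mem_closure_iff_proj (p := p)).2 fun U => ?_
  obtain ⟨m, hm⟩ := U.index_eq
  let q := QuotientGroup.mk' U.toSubgroup
  let V : Subgroup Φ := (H.map (proj U)).comap q
  have hVn : (H.map (proj U)).Normal := Normal.map inferInstance _ (proj_surjective U)
  have hVn' : V.Normal := inferInstance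
  have hUV : U.toSubgroup ≤ V := fun g hg => by
    change q g ∈ H.map (proj U)
    rw [show q g = 1 from (QuotientGroup.eq_one_iff g).2 hg]
    exact one_mem _
  obtain ⟨n, -, hn⟩ := (Nat.dvd_prime_pow hp).1 (hm ▸ index_dvd_of_le hUV)
  -- In the exponent `m + k`, `k` pays for extracting the `p ^ k`-th root and `m` leaves a `p ^
  -- m`-th power, which is trivial modulo `U`, of index `p ^ m`.
  let K : PPowerSubgroup p Φ := ⟨commutatorPow V (p ^ (m + k)), inferInstance,
    exists_index_commutatorPow_eq p V ⟨n, hn⟩ (m + k)⟩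
  obtain ⟨L, hLK, hLU⟩ := K.exists_le_inf U
  -- Since `L ≤ U`, a representative at level `L` also represents `y` modulo `U`, which puts it in
  -- `V`.
  have happrox : ∀ y ∈ H, ∃ g ∈ V, proj L y = QuotientGroup.mk g := fun y hy => by
    obtain ⟨g, hg⟩ := QuotientGroup.mk_surjective (proj L y)
    exact ⟨g, ⟨y, hy, proj_eq_mk_of_le hLU hg.symm⟩, hg.symm⟩
  have hcomm : ⁅H, H⁆ ≤ (proj K).ker := by
    rw [commutator_le]
    intro a ha b hb
    obtain ⟨a', ha', haL⟩ := happrox a ha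
    obtain ⟨b', hb', hbL⟩ := happrox b hb
    rw [MonoidHom.mem_ker, map_commutatorElement, proj_eq_mk_of_le hLK haL,
      proj_eq_mk_of_le hLK hbL]
    exact (QuotientGroup.eq_one_iff ⁅a', b'⁆).2
      (commutator_le_commutatorPow V _ (commutator_mem_commutator ha' hb'))
  obtain ⟨c, hc, hcx⟩ := mem_closure_iff_proj.1 h K
  obtain ⟨x', hx', hxL⟩ := happrox x hx
  have hpow : x' ^ p ^ k ∈ commutatorPow V (p ^ (m + k)) := by
    rw [MonoidHom.mem_ker.1 (hcomm hc), map_pow, proj_eq_mk_of_le hLK hxL] at hcx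
    exact (QuotientGroup.eq_one_iff (x' ^ p ^ k)).1 hcx.symm
  obtain ⟨-, y, hy, hxy⟩ := mem_commutatorPow.1 hpow
  rw [pow_add] at hxy
  -- From `x' ^ p ^ k ≡ y ^ p ^ (m + k)` modulo `[V, V]` follows `x' ≡ y ^ p ^ m`.
  have hmem := mul_inv_pow_mem_commutator_of_isFreeGroup V hx' hy (pow_ne_zero k hp.ne_zero) hxy
  have hyU : y ^ p ^ m ∈ U.toSubgroup := hm ▸ pow_index_mem U.toSubgroup y
  have hmap : q (x' * (y ^ p ^ m)⁻¹) ∈ ⁅H.map (proj U), H.map (proj U)⁆ :=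
    commutator_le_comap (R := V) (H := V) le_rfl le_rfl hmem
  rw [← map_commutator] at hmap
  obtain ⟨z, hz, hzx⟩ := hmap
  refine ⟨z, hz, ?_⟩
  rw [hzx, proj_eq_mk_of_le hLU hxL, map_mul, map_inv,
    show q (y ^ p ^ m) = 1 from (QuotientGroup.eq_one_iff _).2 hyU, inv_one, mul_one]
  rfl

end ProPCompletion

end ProPCompletion

/-! ### Independence of the presentation for pro-`p` groups -/

section ProPPresentation

open Subgroup

theorem topologicalClosure_le_comap {F F' : Type*} [Group F] [TopologicalSpace F]
    [IsTopologicalGroup F] [Group F'] [TopologicalSpace F'] [IsTopologicalGroup F']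
    {C : Subgroup F} {C' : Subgroup F'} {f : F →* F'} (hf : Continuous f) (h : C ≤ C'.comap f) :
    C.topologicalClosure ≤ C'.topologicalClosure.comap f := fun _ hx =>
  map_mem_closure hf hx h

/-- Lift on the abstract free group and extend continuously; the two maps to the Hausdorff group `G`
agree on a dense subgroup, hence everywhere. -/
theorem FreeProP.exists_lift_of_surjective {p : ℕ} [Fact p.Prime] {X : Type v} [Finite X]
    {Y : Type w} [Finite Y] {G : Type u} [Group G] [TopologicalSpace G] [T2Space G]
    {π : FreeProP p X →* G} {ρ : FreeProP p Y →* G} (hπ : Continuous π) (hρ : Continuous ρ)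
    (hs : Function.Surjective ρ) :
    ∃ f : FreeProP p X →* FreeProP p Y, Continuous f ∧ ∀ x, ρ (f x) = π x := by
  obtain ⟨θ, hθ⟩ := FreeGroup.exists_lift_of_surjective (π.comp (ProPCompletion.of p)) hs
  refine ⟨ProPCompletion.lift θ, ProPCompletion.continuous_lift θ, fun x => ?_⟩
  exact congrFun (ProPCompletion.denseRange_of.equalizer
    (hρ.comp (ProPCompletion.continuous_lift θ)) hπ (funext hθ)) x

theorem isProPQuasirational_of_surjective {p : ℕ} [Fact p.Prime] {X : Type v} [Finite X]
    {Y : Type w} [Finite Y] {G : Type u} [Group G] [TopologicalSpace G] [T2Space G]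
    {π : FreeProP p X →* G} {ρ : FreeProP p Y →* G} (hπ : Continuous π) (hρ : Continuous ρ)
    (hπs : Function.Surjective π) (hρs : Function.Surjective ρ) (h : IsProPQuasirational ρ) :
    IsProPQuasirational π := by
  intro n hn
  obtain ⟨f, hfc, hf⟩ := FreeProP.exists_lift_of_surjective hπ hρ hρs
  obtain ⟨g, hgc, hg⟩ := FreeProP.exists_lift_of_surjective hρ hπ hπs
  have h' := (quotient_torsion_iff p).1 (h n hn)
  refine (quotient_torsion_iff p).2 fun x hx k hk => ?_
  have hRf := ker_le_comap_ker hf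
  have hRg := ker_le_comap_ker hg
  have hf1 := h' (f x) (hRf hx) k (by
    rw [← map_pow]
    exact topologicalClosure_le_comap hfc (commutator_le_comap hRf
      (sup_le_comap_sup hRf (proPZassenhaus_le_comap f hfc p n))) hk)
  have hg1 := topologicalClosure_le_comap hgc (commutator_le_comap hRg
      (sup_le_comap_sup hRg (proPZassenhaus_le_comap g hgc p n))) hf1
  rw [mem_comap] at hg1
  have hx' := ProPCompletion.mem_closure_commutator_of_pow_mem
    (π.ker ⊔ proPZassenhaus p (FreeProP p X) n) (le_sup_left (a := π.ker) hx)
    (topologicalClosure_mono (commutator_mono le_sup_left le_rfl) hk)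
  let C := ⁅π.ker, π.ker ⊔ proPZassenhaus p (FreeProP p X) n⁆.topologicalClosure
  -- Triviality of `g ∘ f` modulo the closed subgroup `C` is a closed condition, so it passes from
  -- `[H, H]` to its closure, where `x` lies.
  have hclosed : IsClosed {y : FreeProP p X | y⁻¹ * g (f y) ∈ C} :=
    (isClosed_topologicalClosure _).preimage (continuous_inv.mul (hgc.comp hfc))
  have key : x⁻¹ * g (f x) ∈ C := closure_minimal (fun y hy =>
    inv_mul_map_mem_of_mem_commutator (R := π.ker) (C := C) le_sup_left (le_topologicalClosure _)
      (g.comp f) (fun y _ => by simp [MonoidHom.mem_ker, hg, hf]) hy) hclosed hx'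
  have := mul_mem hg1 (inv_mem key)
  simpa using this

end ProPPresentation

end QRat

theorem mainTheorem3 :
    (∀ (G : Type u) [Group G] (X : Type v) [Finite X] (Y : Type w) [Finite Y]
      (π : FreeGroup X →* G) (ρ : FreeGroup Y →* G),
      QRat.IsPresentation π → QRat.IsPresentation ρ →
        (QRat.IsQuasirational π ↔ QRat.IsQuasirational ρ)) ∧
    (∀ (p : ℕ) [Fact p.Prime] (G : Type u) [Group G] [TopologicalSpace G]
      (X : Type v) [Finite X] (Y : Type w) [Finite Y]
      (π : QRat.FreeProP p X →* G) (ρ : QRat.FreeProP p Y →* G),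
      QRat.IsProP p G → QRat.IsProPPresentation π → QRat.IsProPPresentation ρ →
        (QRat.IsProPQuasirational π ↔ QRat.IsProPQuasirational ρ)) := by
  refine ⟨fun G _ X _ Y _ π ρ hπ hρ => ?_, fun p _ G _ _ X _ Y _ π ρ hG hπ hρ => ?_⟩
  · exact ⟨QRat.isQuasirational_of_surjective hρ.surjective hπ.surjective,
      QRat.isQuasirational_of_surjective hπ.surjective hρ.surjective⟩
  · have := hG.t2Space
    exact ⟨QRat.isProPQuasirational_of_surjective hρ.continuous hπ.continuous hρ.surjective
        hπ.surjective,
      QRat.isProPQuasirational_of_surjective hπ.continuous hρ.continuous hπ.surjective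
        hρ.surjective⟩
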